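/- An effect algebra is a set $E$ with two distinct elements $0,1$ and a partial binary operation $\oplus$ such that, for all $a,b,c\in E$: $b\oplus a=a\oplus b$ if $a\oplus b$ is defined; $(a\oplus b)\oplus c=a\oplus(b\oplus c)$ if one side is defined; there is a unique $a'\in E$ with $a\oplus a'=1$; and if $1\oplus a$ is defined then $a=0$. It is ordered by $a\le b$ iff $a\oplus c=b$ for some $c\in E$ (then $c$ is unique and is written $b\ominus a$), and $a\oplus b$ is defined iff $a\le b'$. It is a complete lattice effect algebra if this order is a complete lattice, and it is atomic if every nonzero element lies above an atom (a minimal nonzero element). Elements $x,y$ are compatible if $x\vee y=x\oplus(y\ominus(x\wedge y))$; a block is a maximal set of pairwise compatible elements; $E$ is block-finite if it has only finitely many blocks. The interval topology $\tau_i$ on $E$ is the topology with the intervals $[a,b]=\{z\in E: a\le z\le b\}$, $a\le b$, as a closed subbasis. A net $(x_\alpha)_{\alpha\in\mathcal E}$, indexed by a nonempty directed set, order converges to $x$ if there are nets $(u_\alpha)_{\alpha\in\mathcal E}$ and $(v_\alpha)_{\alpha\in\mathcal E}$, the first nondecreasing with $\bigvee_\alpha u_\alpha=x$ and the second nonincreasing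 with $\bigwedge_\alpha v_\alpha=x$, such that $u_\alpha\le x_\alpha\le v_\alpha$ for all $\alpha$. The order topology $\tau_o$ is the finest topology on $E$ in which every order convergent net converges to its order limits. Theorem. Let $E$ be a block-finite complete atomic lattice effect algebra. Let $(x_\alpha)_{\alpha\in\mathcal E}$ and $(y_\alpha)_{\alpha\in\mathcal E}$ be nets of elements of $E$ over the same nonempty directed set $\mathcal E$ such that $x_\alpha\le y_\alpha'$ for all $\alpha\in\mathcal E$, and let $x,y\in E$. If $x_\alpha\to x$ and $y_\alpha\to y$ in $\tau_i$, then $x\le y'$ and $x_\alpha\oplus y_\alpha\to x\oplus y$ in $\tau_i$. Moreover, $\tau_i=\tau_o$. -/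

import Mathlib

universe u v

/-- An effect algebra `(E; ⊕, 0, 1)`. The partial operation `⊕` is a map to `Option E`;
`oplus a b = none` means that `a ⊕ b` is not defined. -/
class EffectAlgebra (E : Type*) extends Zero E, One E where
  /-- the partial sum `a ⊕ b` -/
  oplus : E → E → Option E
  zero_ne_one : (0 : E) ≠ 1
  oplus_comm : ∀ a b : E, oplus a b = oplus b a
  /-- `(a ⊕ b) ⊕ c = a ⊕ (b ⊕ c)`, both sides being defined as soon as one of them is -/
  oplus_assoc : ∀ a b c : E,
    ((oplus a b).bind fun d => oplus d c) = ((oplus b c).bind fun d => oplus a d)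
  existsUnique_orthosupplement : ∀ a : E, ∃! b : E, oplus a b = some 1
  eq_zero_of_one_oplus : ∀ a : E, (oplus 1 a).isSome → a = 0

/-- A lattice effect algebra: an effect algebra that is a lattice in the order
`a ≤ b ↔ ∃ c, a ⊕ c = b`. -/
class LatticeEffectAlgebra (E : Type*) extends EffectAlgebra E, Lattice E where
  le_iff_exists_oplus : ∀ a b : E, a ≤ b ↔ ∃ c : E, oplus a c = some b

/-- A complete lattice effect algebra: a lattice effect algebra whose order is complete. -/
class CompleteLatticeEffectAlgebra (E : Type*) extends
  LatticeEffectAlgebra E, CompleteLattice E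

namespace EffectAlgebra

/-- The orthosupplement `a'`, the unique element with `a ⊕ a' = 1`. -/
noncomputable def orthosupplement {E : Type*} [EffectAlgebra E] (a : E) : E :=
  (existsUnique_orthosupplement a).choose

theorem oplus_orthosupplement {E : Type*} [EffectAlgebra E] (a : E) :
    oplus a (orthosupplement a) = some 1 :=
  (existsUnique_orthosupplement a).choose_spec.1

theorem isSome_oplus {E : Type*} [LatticeEffectAlgebra E] {a b : E}
    (h : a ≤ orthosupplement b) : (oplus a b).isSome := by
  obtain ⟨c, hc⟩ := (LatticeEffectAlgebra.le_iff_exists_oplus _ _).1 h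
  have h1 := oplus_assoc c a b
  rw [oplus_comm c a, hc, Option.bind_some, oplus_comm, oplus_orthosupplement] at h1
  cases hab : oplus a b with
  | none => simp [hab] at h1
  | some d => simp

/-- The sum `a ⊕ b` of two elements with `a ≤ b'`, as an element of `E`. -/
noncomputable def osum {E : Type*} [LatticeEffectAlgebra E] (a b : E)
    (h : a ≤ orthosupplement b) : E :=
  (oplus a b).get (isSome_oplus h)

theorem oplus_eq_some_osum {E : Type*} [LatticeEffectAlgebra E] (a b : E)
    (h : a ≤ orthosupplement b) : oplus a b = some (osum a b h) := by
  simp [osum]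

/-- Compatibility `x ↔ y`, that is `x ∨ y = x ⊕ (y ⊖ (x ∧ y))`;
here `c = y ⊖ (x ∧ y)` means `(x ∧ y) ⊕ c = y`. -/
def Compatible {E : Type*} [LatticeEffectAlgebra E] (x y : E) : Prop :=
  ∃ c : E, oplus (x ⊓ y) c = some y ∧ oplus x c = some (x ⊔ y)

/-- A block: a maximal subset of pairwise compatible elements. -/
def IsBlock {E : Type*} [LatticeEffectAlgebra E] (M : Set E) : Prop :=
  Maximal (fun S : Set E => ∀ x ∈ S, ∀ y ∈ S, Compatible x y) M

/-- `E` has only finitely many blocks. -/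
def BlockFinite (E : Type*) [LatticeEffectAlgebra E] : Prop :=
  {M : Set E | IsBlock M}.Finite

theorem oplus_zero {E : Type*} [EffectAlgebra E] (a : E) : oplus a 0 = some a := by
  have h1 : orthosupplement (1 : E) = 0 :=
    eq_zero_of_one_oplus _ (by simp [oplus_orthosupplement])
  have h2 : oplus (1 : E) 0 = some 1 := by
    have := oplus_orthosupplement (1 : E)
    rwa [h1] at this
  have h3 : oplus (orthosupplement a) a = some 1 := by
    rw [oplus_comm, oplus_orthosupplement]
  have h4 := oplus_assoc (orthosupplement a) a 0
  rw [h3, Option.bind_some, h2] at h4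
  cases hd : oplus a 0 with
  | none => simp [hd] at h4
  | some d =>
    rw [hd, Option.bind_some] at h4
    rw [(existsUnique_orthosupplement (orthosupplement a)).unique h4.symm h3]

/-- The least element of the lattice is the `0` of the effect algebra, so `IsAtom` and
`IsAtomic` have their effect-algebraic meaning. -/
theorem bot_eq_zero {E : Type*} [CompleteLatticeEffectAlgebra E] : (⊥ : E) = 0 :=
  le_antisymm bot_le ((LatticeEffectAlgebra.le_iff_exists_oplus _ _).2
    ⟨⊥, by rw [oplus_comm, oplus_zero]⟩)

end EffectAlgebra

/-- The interval topology: the closed intervals `[a, b]`, `a ≤ b`, are a closed subbasis. -/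
@[reducible] def intervalTopology (L : Type*) [Preorder L] : TopologicalSpace L :=
  TopologicalSpace.generateFrom {U : Set L | ∃ a b : L, a ≤ b ∧ U = (Set.Icc a b)ᶜ}

/-- Order convergence of a net: `a ↑ u i ≤ x i ≤ v i ↓ a`. -/
def OrderConverges {I L : Type*} [Preorder I] [Preorder L] (x : I → L) (a : L) : Prop :=
  ∃ u v : I → L, (∀ i, u i ≤ x i ∧ x i ≤ v i) ∧
    Monotone u ∧ IsLUB (Set.range u) a ∧ Antitone v ∧ IsGLB (Set.range v) a

/-- Every order convergent net (indexed by a directed set in the universe of `L`)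
converges to the same point in the topology `τ`. -/
def RespectsOrderConvergence {L : Type u} [Preorder L] (τ : TopologicalSpace L) : Prop :=
  ∀ (I : Type u) [Preorder I] [IsDirectedOrder I] [Nonempty I] (x : I → L) (a : L),
    OrderConverges x a → Filter.Tendsto x Filter.atTop (@nhds L τ a)

/-- The order topology: the finest topology in which order convergent nets converge.
(In Mathlib `τ₁ ≤ τ₂` means that `τ₁` is finer than `τ₂`, so this is an infimum.) -/
@[reducible] def orderTopology (L : Type u) [Preorder L] : TopologicalSpace L :=
  sInf {τ : TopologicalSpace L | RespectsOrderConvergence τ}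

/-- `orderTopology L` has the defining property, and is the finest such topology. -/
theorem isLeast_orderTopology (L : Type u) [Preorder L] :
    IsLeast {τ : TopologicalSpace L | RespectsOrderConvergence τ} (orderTopology L) := by
  refine ⟨fun I _ _ _ x a h => ?_, fun τ hτ => sInf_le hτ⟩
  rw [orderTopology, nhds_sInf]
  simp only [Filter.tendsto_iInf]
  exact fun τ hτ => hτ I x a h

/-- Order convergent nets indexed by directed sets in any universe converge in the order
topology, so that the restriction of the universe in its definition is immaterial. -/
theorem OrderConverges.tendsto_orderTopology {L : Type u} [Preorder L]
    {I : Type v} [Preorder I] [IsDirectedOrder I] [Nonempty I] {x : I → L} {a : L}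
    (h : OrderConverges x a) :
    Filter.Tendsto x Filter.atTop (@nhds L (orderTopology L) a) := by
  obtain ⟨p, q, hx, hp, hpa, hq, hqa⟩ := h
  by_contra hcon
  let _ : TopologicalSpace L := orderTopology L
  obtain ⟨U, hU, haU⟩ : ∃ U ∈ nhds a, ¬ ∀ᶠ i in Filter.atTop, x i ∈ U := by
    by_contra hne
    push Not at hne
    exact hcon fun U hU => hne U hU
  have hfr : ∀ i : I, ∃ k, i ≤ k ∧ x k ∉ U := by
    intro i
    by_contra hne
    push Not at hne
    exact haU (Filter.eventually_atTop.2 ⟨i, fun k hk => hne k hk⟩)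
  obtain ⟨J, f, hf, hf'⟩ : ∃ (J : Type u) (f : J → L × L × L),
      (∀ j, ∃ i, x i ∉ U ∧ f j = (p i, q i, x i)) ∧
      (∀ i, x i ∉ U → ∃ j, f j = (p i, q i, x i)) :=
    ⟨{t : L × L × L // ∃ i, x i ∉ U ∧ t = (p i, q i, x i)}, Subtype.val,
      fun j => j.2, fun i hi => ⟨⟨_, i, hi, rfl⟩, rfl⟩⟩
  let _ : Preorder J := Preorder.lift fun j => ((f j).1, OrderDual.toDual (f j).2.1)
  have hle : ∀ j k : J, j ≤ k ↔ (f j).1 ≤ (f k).1 ∧ (f k).2.1 ≤ (f j).2.1 :=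
    fun _ _ => Iff.rfl
  have : Nonempty J := by
    obtain ⟨k, -, hk⟩ := hfr (Classical.arbitrary I)
    exact ⟨(hf' k hk).choose⟩
  have : IsDirectedOrder J := by
    refine ⟨fun s t => ?_⟩
    obtain ⟨i, hi, hs⟩ := hf s
    obtain ⟨j, hj, ht⟩ := hf t
    obtain ⟨m, him, hjm⟩ := exists_ge_ge i j
    obtain ⟨k, hmk, hk⟩ := hfr m
    obtain ⟨r, hr⟩ := hf' k hk
    refine ⟨r, (hle _ _).2 ?_, (hle _ _).2 ?_⟩
    · rw [hs, hr]
      exact ⟨hp (him.trans hmk), hq (him.trans hmk)⟩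
    · rw [ht, hr]
      exact ⟨hp (hjm.trans hmk), hq (hjm.trans hmk)⟩
  have key : OrderConverges (fun t : J => (f t).2.2) a := by
    refine ⟨fun t => (f t).1, fun t => (f t).2.1, ?_, fun _ _ h => ((hle _ _).1 h).1, ⟨?_, ?_⟩,
      fun _ _ h => ((hle _ _).1 h).2, ⟨?_, ?_⟩⟩
    · intro t
      obtain ⟨i, hi, ht⟩ := hf t
      simp only [ht]
      exact hx i
    · rintro _ ⟨t, rfl⟩
      obtain ⟨i, hi, ht⟩ := hf t
      simp only [ht]
      exact hpa.1 ⟨i, rfl⟩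
    · intro b hb
      refine hpa.2 ?_
      rintro _ ⟨i, rfl⟩
      obtain ⟨k, hik, hk⟩ := hfr i
      obtain ⟨r, hr⟩ := hf' k hk
      have := hb ⟨r, rfl⟩
      simp only [hr] at this
      exact (hp hik).trans this
    · rintro _ ⟨t, rfl⟩
      obtain ⟨i, hi, ht⟩ := hf t
      simp only [ht]
      exact hqa.1 ⟨i, rfl⟩
    · intro b hb
      refine hqa.2 ?_
      rintro _ ⟨i, rfl⟩
      obtain ⟨k, hik, hk⟩ := hfr i
      obtain ⟨r, hr⟩ := hf' k hk
      have := hb ⟨r, rfl⟩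
      simp only [hr] at this
      exact this.trans (hq hik)
  have hev : ∀ᶠ t in Filter.atTop, (f t).2.2 ∈ U :=
    (isLeast_orderTopology L).1 J _ a key hU
  obtain ⟨t, ht⟩ := Filter.Eventually.exists hev
  obtain ⟨i, hi, ht'⟩ := hf t
  simp only [ht'] at ht
  exact hi ht

/-! Convergence is tested on ultrafilters. Along an ultrafilter `G`, block-finiteness puts `x i` and
`y i`, which are compatible, eventually into one fixed block `M`. For `f` eventually in `M`, let
L(f) be the supremum of the elements of `M` that are eventually below `f`.

The core is `lowerLimit_add_add_eq_one`: if f ⊕ g ⊕ h = 1 eventually, then L(f) ⊕ L(g) ⊕ L(h) = 1.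
If the sum fell short of 1, an atom p ∈ `M` would fit into the gap. But f, g, h have eventual lower
bounds a, b, c in `M` that cannot be enlarged by p, while p lies below the sum of the three
remainders. An atom compatible with the remainders must lie below one of them, a contradiction. That
the gap contains an atom belonging to `M` is `IsBlock.exists_isAtom_le`, which again uses
block-finiteness.

With g = 0, L commutes with orthosupplements, so lower and upper limits coincide: L(f) is the only
interval limit of `f` along `G`, and also an order limit. This gives τ_i = τ_o. With h = (x ⊕ y)', L
is additive, which gives continuity of ⊕. -/

namespace EffectAlgebra

/-! ### Total addition on `WithTop E` and cancellation -/

section PartialSum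

variable {E : Type*} [LatticeEffectAlgebra E]

/-- The partial sum of an effect algebra made total by adjoining the value `⊤` for
"undefined". -/
instance withTopAdd : Add (WithTop E) where
  add x y := Option.bind x fun a => Option.bind y fun b => oplus a b

instance withTopAddCommMonoid : AddCommMonoid (WithTop E) where
  zero := ((0 : E) : WithTop E)
  add_assoc x y z := by
    change Option.bind (Option.bind x fun a => Option.bind y fun b => oplus a b)
        (fun d => Option.bind z fun c => oplus d c) =
      Option.bind x fun a => Option.bind (Option.bind y fun b => Option.bind z fun c => oplus b c)
        fun d => oplus a d
    rcases x with _ | a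
    · rfl
    rcases y with _ | b
    · rfl
    rcases z with _ | c
    · simp
    · simpa using oplus_assoc a b c
  add_comm x y := by
    change (Option.bind x fun a => Option.bind y fun b => oplus a b) =
      Option.bind y fun a => Option.bind x fun b => oplus a b
    rcases x with _ | a <;> rcases y with _ | b <;> simp [oplus_comm]
  zero_add x := by
    change (Option.bind (some 0) fun a => Option.bind x fun b => oplus a b) = x
    rcases x with _ | a
    · rfl
    · simp [oplus_comm, oplus_zero]
  add_zero x := by
    change (Option.bind x fun a => Option.bind (some 0) fun b => oplus a b) = x
    rcases x with _ | a
    · rfl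
    · simp [oplus_zero]
  nsmul := nsmulRec

theorem add_eq_coe {a b c : E} : (a : WithTop E) + b = c ↔ oplus a b = some c := Iff.rfl

theorem withTop_zero : ((0 : E) : WithTop E) = 0 := rfl

theorem withTop_top_add (x : WithTop E) : ⊤ + x = ⊤ := rfl

theorem coe_le_iff_exists_add {a b : E} : a ≤ b ↔ ∃ c : E, (a : WithTop E) + c = b :=
  LatticeEffectAlgebra.le_iff_exists_oplus a b

theorem coe_add_orthosupplement (a : E) :
    (a : WithTop E) + (orthosupplement a : E) = (1 : E) := oplus_orthosupplement a

theorem le_one (a : E) : a ≤ 1 := coe_le_iff_exists_add.2 ⟨_, coe_add_orthosupplement a⟩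

instance : CanonicallyOrderedAdd (WithTop E) where
  exists_add_of_le {x y} h := by
    induction y with
    | top => exact ⟨⊤, by rw [add_comm, withTop_top_add]⟩
    | coe b =>
      induction x with
      | top => simp at h
      | coe a =>
        obtain ⟨c, hc⟩ := coe_le_iff_exists_add.1 (WithTop.coe_le_coe.1 h)
        exact ⟨c, hc.symm⟩
  le_self_add x y := by
    rcases h : x + y with _ | b
    · exact le_top
    induction x with
    | top => cases h
    | coe a =>
      induction y with
      | top => rw [add_comm] at h; cases h
      | coe c => exact WithTop.coe_le_coe.2 (coe_le_iff_exists_add.2 ⟨c, h⟩)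
  le_add_self x y := by
    rw [add_comm]
    rcases h : x + y with _ | b
    · exact le_top
    induction x with
    | top => cases h
    | coe a =>
      induction y with
      | top => rw [add_comm] at h; cases h
      | coe c => exact WithTop.coe_le_coe.2 (coe_le_iff_exists_add.2 ⟨c, h⟩)

instance : IsOrderedAddMonoid (WithTop E) where
  add_le_add_left x y h z := by
    obtain ⟨c, rfl⟩ := exists_add_of_le h
    rw [add_right_comm]
    exact le_self_add

theorem exists_coe_add_of_coe_le {a b : E} {x : WithTop E} (h : x + a ≤ b) :
    ∃ c : E, x + a = c ∧ c ≤ b := by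
  lift x + a to E using ne_top_of_le_ne_top WithTop.coe_ne_top h with c
  exact ⟨c, rfl, WithTop.coe_le_coe.1 h⟩

/-- With s = x + y, both `y` and `z` are the unique orthosupplement of x + s'. -/
theorem withTop_add_left_cancel {x y z : WithTop E} (h : x + y = x + z) (hx : x + y ≠ ⊤) :
    y = z := by
  have key : ∀ u : WithTop E, ∀ s' : E, x + u + s' = (1 : E) →
      ∃ d : E, x + s' = d ∧ u = (orthosupplement d : E) := by
    intro u s' hu
    have hu' : x + s' + u = (1 : E) := by rw [← hu]; abel
    have h1 : x + s' ≠ ⊤ := by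
      intro h0; rw [h0, withTop_top_add] at hu'; exact WithTop.top_ne_coe hu'
    have h2 : u ≠ ⊤ := by
      rintro rfl; rw [add_comm, withTop_top_add] at hu'; exact WithTop.top_ne_coe hu'
    lift x + s' to E using h1 with d
    lift u to E using h2
    refine ⟨d, rfl, ?_⟩
    rw [(existsUnique_orthosupplement d).unique hu' (oplus_orthosupplement d)]
  obtain ⟨s, hs⟩ := WithTop.ne_top_iff_exists.1 hx
  obtain ⟨d, hd, hy⟩ := key y _ (hs ▸ coe_add_orthosupplement s)
  obtain ⟨d', hd', hz⟩ := key z (orthosupplement s) (by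
    rw [← h, ← hs]; exact coe_add_orthosupplement s)
  rw [hd, WithTop.coe_inj] at hd'
  rw [hy, hz, hd']

theorem le_of_withTop_add_le_add_left {x y z : WithTop E} (h : x + y ≤ x + z) (hx : x + z ≠ ⊤) :
    y ≤ z := by
  obtain ⟨c, hc⟩ := exists_add_of_le h
  rw [add_assoc] at hc
  rw [withTop_add_left_cancel hc hx]
  exact le_self_add

theorem withTop_le_one {x : WithTop E} (hx : x ≠ ⊤) : x ≤ (1 : E) := by
  lift x to E using hx
  exact WithTop.coe_le_coe.2 (le_one x)

theorem ne_top_of_le_coe {x : WithTop E} {a : E} (h : x ≤ a) : x ≠ ⊤ :=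
  ne_top_of_le_ne_top WithTop.coe_ne_top h

theorem add_ne_top_iff {x : WithTop E} {b : E} :
    x + b ≠ ⊤ ↔ x ≤ (orthosupplement b : E) := by
  refine ⟨fun h => ?_, fun h => ne_top_of_le_coe (a := 1) ?_⟩
  · have := withTop_le_one h
    rw [← coe_add_orthosupplement b, add_comm x] at this
    exact le_of_withTop_add_le_add_left this (by rw [coe_add_orthosupplement]; simp)
  · rw [← coe_add_orthosupplement b, add_comm (b : WithTop E)]
    gcongr

theorem orthosupplement_eq_of_add_eq_one {a b : E} (h : (a : WithTop E) + b = (1 : E)) :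
    orthosupplement a = b :=
  (existsUnique_orthosupplement a).unique (oplus_orthosupplement a) h

@[simp] theorem orthosupplement_orthosupplement (a : E) :
    orthosupplement (orthosupplement a) = a :=
  orthosupplement_eq_of_add_eq_one (by rw [add_comm, coe_add_orthosupplement])

theorem le_orthosupplement_comm {a b : E} :
    a ≤ orthosupplement b ↔ b ≤ orthosupplement a := by
  rw [← WithTop.coe_le_coe, ← add_ne_top_iff, add_comm, add_ne_top_iff, WithTop.coe_le_coe]

theorem orthosupplement_le_orthosupplement {a b : E} :
    orthosupplement a ≤ orthosupplement b ↔ b ≤ a := by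
  rw [le_orthosupplement_comm, orthosupplement_orthosupplement]

theorem withTop_eq_zero_of_add_le {x y : WithTop E} (h : x + y ≤ x) (hx : x ≠ ⊤) : y = 0 := by
  have h0 : x + y ≤ x + 0 := by simpa using h
  have := le_of_withTop_add_le_add_left h0 (by simpa using hx)
  exact le_antisymm this zero_le

theorem coe_osum {a b : E} (h : a ≤ orthosupplement b) :
    ((osum a b h : E) : WithTop E) = (a : WithTop E) + b :=
  (oplus_eq_some_osum a b h).symm

end PartialSum

/-! ### Compatibility of two elements -/

section Compatible

variable {E : Type*} [LatticeEffectAlgebra E]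

/-- Compatibility in terms of a splitting of one of the two elements. -/
def Splits (x z : E) : Prop :=
  ∃ p q : E, p ≤ z ∧ (p : WithTop E) + q = x ∧ (q : WithTop E) + z ≠ ⊤

theorem Splits.symm {x z : E} (h : Splits x z) : Splits z x := by
  obtain ⟨p, q, hp, hx, hq⟩ := h
  obtain ⟨r, hr⟩ := coe_le_iff_exists_add.1 hp
  refine ⟨p, r, coe_le_iff_exists_add.2 ⟨q, hx⟩, hr, ?_⟩
  rw [← hr] at hq
  rw [← hx]
  convert hq using 1
  abel

/-- With e = z ⊖ (x ∧ z) and c = x ⊖ (x ∧ z), the sum x + e = z + c is defined and bounds `x` and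
`z`. Its excess g over x ∨ z is below both c and e, so (x ∧ z) + g ≤ x ∧ z and g = 0. -/
theorem Splits.exists_inf_add_sup {x z : E} (h : Splits x z) :
    ∃ c : E, ((x ⊓ z : E) : WithTop E) + c = x ∧ (z : WithTop E) + c = (x ⊔ z : E) := by
  obtain ⟨p, q, hp, hx, hq⟩ := h
  obtain ⟨c, hc⟩ := coe_le_iff_exists_add.1 (inf_le_left : x ⊓ z ≤ x)
  obtain ⟨e, he⟩ := coe_le_iff_exists_add.1 (inf_le_right : x ⊓ z ≤ z)
  have hpx : p ≤ x := coe_le_iff_exists_add.2 ⟨q, hx⟩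
  obtain ⟨r, hr⟩ := coe_le_iff_exists_add.1 (le_inf hpx hp)
  have hzc : (x : WithTop E) + e ≠ ⊤ := by
    have h1 : (x : WithTop E) + e + r = q + z := by
      rw [← hx, ← he, ← hr]; abel
    intro h0
    rw [h0, withTop_top_add] at h1
    exact hq h1.symm
  have hse : (z : WithTop E) + c = x + e := by
    rw [← hc]; nth_rewrite 1 [← he]; abel
  refine ⟨c, hc, ?_⟩
  have hle : ((x ⊔ z : E) : WithTop E) ≤ x + e := by
    rw [WithTop.coe_sup]
    exact sup_le le_self_add (hse ▸ le_self_add)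
  obtain ⟨g, hg⟩ := exists_add_of_le hle
  obtain ⟨m, hm⟩ := coe_le_iff_exists_add.1 (le_sup_left : x ≤ x ⊔ z)
  obtain ⟨n, hn⟩ := coe_le_iff_exists_add.1 (le_sup_right : z ≤ x ⊔ z)
  have hge : g ≤ e := by
    have : (x : WithTop E) + e = x + (m + g) := by rw [hg, ← hm, add_assoc]
    rw [withTop_add_left_cancel this hzc]
    exact le_add_self
  have hgc : g ≤ c := by
    have : (z : WithTop E) + c = z + (n + g) := by rw [hse, hg, ← hn, add_assoc]
    rw [withTop_add_left_cancel this (hse ▸ hzc)]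
    exact le_add_self
  have hg0 : g = 0 := by
    refine withTop_eq_zero_of_add_le (x := ((x ⊓ z : E) : WithTop E)) ?_ WithTop.coe_ne_top
    nth_rewrite 2 [WithTop.coe_inf]
    refine le_inf ?_ ?_
    · rw [← hc]; gcongr
    · rw [← he]; gcongr
  rw [hse, hg, hg0, add_zero]

theorem compatible_iff_splits {x z : E} : Compatible x z ↔ Splits x z := by
  refine ⟨fun ⟨c, h1, h2⟩ => Splits.symm ⟨x ⊓ z, c, inf_le_left, h1, ?_⟩, fun h => ?_⟩
  · rw [add_comm, add_eq_coe.2 h2]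
    exact WithTop.coe_ne_top
  · obtain ⟨c, h1, h2⟩ := h.symm.exists_inf_add_sup
    rw [inf_comm] at h1
    rw [sup_comm] at h2
    exact ⟨c, h1, h2⟩

theorem Compatible.symm {x z : E} (h : Compatible x z) : Compatible z x :=
  compatible_iff_splits.2 (compatible_iff_splits.1 h).symm

theorem compatible_of_le {x z : E} (h : x ≤ z) : Compatible x z := by
  refine compatible_iff_splits.2 ⟨x, 0, h, ?_, ?_⟩
  · rw [withTop_zero, add_zero]
  · rw [withTop_zero, zero_add]; exact WithTop.coe_ne_top

theorem compatible_of_add_ne_top {x z : E} (h : (x : WithTop E) + z ≠ ⊤) : Compatible x z := by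
  refine compatible_iff_splits.2 ⟨0, x, ?_, ?_, h⟩
  · exact coe_le_iff_exists_add.2 ⟨z, by rw [withTop_zero, zero_add]⟩
  · rw [withTop_zero, zero_add]

theorem Compatible.orthosupplement_right {x z : E} (h : Compatible x z) :
    Compatible x (orthosupplement z) := by
  obtain ⟨p, q, hp, hx, hq⟩ := compatible_iff_splits.1 h
  refine compatible_iff_splits.2 ⟨q, p, WithTop.coe_le_coe.1 (add_ne_top_iff.1 hq), ?_, ?_⟩
  · rw [add_comm, hx]
  · rw [add_ne_top_iff, orthosupplement_orthosupplement]
    exact WithTop.coe_le_coe.2 hp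

theorem Compatible.orthosupplement_left {x z : E} (h : Compatible x z) :
    Compatible (orthosupplement x) z :=
  h.symm.orthosupplement_right.symm

theorem compatible_of_le_or_le_orthosupplement {x z : E}
    (h : x ≤ z ∨ x ≤ orthosupplement z) : Compatible x z := by
  rcases h with h | h
  · exact compatible_of_le h
  · exact compatible_of_add_ne_top (add_ne_top_iff.2 (WithTop.coe_le_coe.2 h))

end Compatible

/-! ### Closure of compatibility under suprema, sums and differences -/

section Complete

variable {E : Type*} [CompleteLatticeEffectAlgebra E]

theorem compatible_sSup {S : Set E} {z : E} (h : ∀ x ∈ S, Compatible x z) :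
    Compatible (sSup S) z := by
  obtain ⟨g, hg⟩ := coe_le_iff_exists_add.1 (inf_le_left : sSup S ⊓ z ≤ sSup S)
  have hq : ((g ⊓ orthosupplement z : E) : WithTop E) + z ≠ ⊤ :=
    add_ne_top_iff.2 (WithTop.coe_le_coe.2 inf_le_right)
  have hle : ((sSup S ⊓ z : E) : WithTop E) + (g ⊓ orthosupplement z : E) ≤ (sSup S : E) := by
    rw [← hg]
    gcongr
    exact WithTop.coe_le_coe.2 inf_le_left
  -- The proposed splitting lies below `sSup S`; equality follows once it dominates each x ∈ `S`,
  -- that is, once c = x ⊖ (x ∧ z) is below both `g` and z'.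
  refine compatible_iff_splits.2 ⟨sSup S ⊓ z, g ⊓ orthosupplement z, inf_le_right,
    le_antisymm hle ?_, hq⟩
  obtain ⟨t, ht, -⟩ := exists_coe_add_of_coe_le hle
  rw [ht, WithTop.coe_le_coe]
  refine sSup_le fun x hx => ?_
  have hxS := le_sSup hx
  obtain ⟨c, hc, hcz⟩ := (compatible_iff_splits.1 (h x hx)).exists_inf_add_sup
  have hcz' : (c : WithTop E) + z ≠ ⊤ := by
    rw [add_comm, hcz]; exact WithTop.coe_ne_top
  have hsp : Splits x (sSup S ⊓ z) := by
    refine ⟨x ⊓ z, c, inf_le_inf_right z hxS, hc, ne_top_of_le_ne_top hcz' ?_⟩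
    gcongr
    exact WithTop.coe_le_coe.2 inf_le_right
  obtain ⟨c', hc', hcw⟩ := hsp.exists_inf_add_sup
  have hcc : c = c' := by
    rw [← inf_assoc, inf_eq_left.2 hxS, ← hc] at hc'
    exact WithTop.coe_inj.1 (withTop_add_left_cancel hc' (hc' ▸ hc ▸ WithTop.coe_ne_top)).symm
  have hcg : c ≤ g := by
    have h1 : ((sSup S ⊓ z : E) : WithTop E) + c ≤ (sSup S ⊓ z : E) + g := by
      rw [hcc, hcw, hg, WithTop.coe_le_coe]
      exact sup_le hxS inf_le_left
    exact WithTop.coe_le_coe.1 (le_of_withTop_add_le_add_left h1 (hg ▸ WithTop.coe_ne_top))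
  rw [← WithTop.coe_le_coe, ← ht, ← hc]
  refine add_le_add (WithTop.coe_le_coe.2 (inf_le_inf_right z hxS)) (WithTop.coe_le_coe.2 ?_)
  exact le_inf hcg (WithTop.coe_le_coe.1 (add_ne_top_iff.1 hcz'))

theorem compatible_sup {x y z : E} (hx : Compatible x z) (hy : Compatible y z) :
    Compatible (x ⊔ y) z := by
  rw [← sSup_pair]
  exact compatible_sSup (by simp [hx, hy])

theorem orthosupplement_sup (x y : E) :
    orthosupplement (x ⊔ y) = orthosupplement x ⊓ orthosupplement y := by
  refine le_antisymm (le_inf ?_ ?_) ?_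
  · exact orthosupplement_le_orthosupplement.2 le_sup_left
  · exact orthosupplement_le_orthosupplement.2 le_sup_right
  · rw [le_orthosupplement_comm]
    exact sup_le (le_orthosupplement_comm.1 inf_le_left) (le_orthosupplement_comm.1 inf_le_right)

theorem compatible_inf {x y z : E} (hx : Compatible x z) (hy : Compatible y z) :
    Compatible (x ⊓ y) z := by
  have := (compatible_sup hx.orthosupplement_left hy.orthosupplement_left).orthosupplement_left
  rwa [orthosupplement_sup, orthosupplement_orthosupplement,
    orthosupplement_orthosupplement] at this

/-- Split `z` along `x`, then z ∧ x along `y`: the part s of z ∧ x outside `y` lies below `d`, and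
the rest of `z` is summable with `d`. -/
theorem compatible_of_add_eq_left {x y d z : E} (h : (y : WithTop E) + d = x)
    (hx : Compatible x z) (hy : Compatible y z) : Compatible d z := by
  have hyx : y ≤ x := coe_le_iff_exists_add.2 ⟨d, h⟩
  obtain ⟨z₂, hz, hzx⟩ := (compatible_iff_splits.1 hx.symm).exists_inf_add_sup
  have h1 : Compatible (z ⊓ x) y := compatible_inf hy.symm (compatible_of_le hyx).symm
  obtain ⟨s, hs, hys⟩ := (compatible_iff_splits.1 h1).exists_inf_add_sup
  have hsd : s ≤ d := by
    have : (y : WithTop E) + s ≤ y + d := by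
      rw [hys, h, WithTop.coe_le_coe]
      exact sup_le inf_le_right hyx
    exact WithTop.coe_le_coe.1 (le_of_withTop_add_le_add_left this (h ▸ WithTop.coe_ne_top))
  have hle : ((z ⊓ x ⊓ y : E) : WithTop E) + z₂ ≤ z := by
    rw [← hz]
    gcongr
    exact WithTop.coe_le_coe.2 inf_le_left
  obtain ⟨t, ht, -⟩ := exists_coe_add_of_coe_le hle
  refine Compatible.symm (compatible_iff_splits.2 ⟨s, t, hsd, ?_, ?_⟩)
  · rw [← hz, ← hs, ← ht]; abel
  · refine ne_top_of_le_ne_top (b := (x : WithTop E) + z₂) (hzx ▸ WithTop.coe_ne_top) ?_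
    rw [← ht, ← h, add_right_comm]
    gcongr
    exact WithTop.coe_le_coe.2 inf_le_right

/-- Sums reduce to differences through s' = x' ⊖ y. -/
theorem compatible_of_add_eq {x y s z : E} (h : (x : WithTop E) + y = s)
    (hx : Compatible x z) (hy : Compatible y z) : Compatible s z := by
  have h1 : (x : WithTop E) + (y + (orthosupplement s : E)) = x + (orthosupplement x : E) := by
    rw [← add_assoc, h, coe_add_orthosupplement, coe_add_orthosupplement]
  have h2 := withTop_add_left_cancel h1 (by
    rw [h1, coe_add_orthosupplement]; exact WithTop.coe_ne_top)
  have := compatible_of_add_eq_left h2 hx.orthosupplement_left hy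
  simpa using this.orthosupplement_left

end Complete

/-! ### Blocks and their atoms -/

section Blocks

theorem exists_isBlock_superset {E : Type*} [LatticeEffectAlgebra E] {A : Set E}
    (hA : ∀ x ∈ A, ∀ y ∈ A, Compatible x y) : ∃ M, A ⊆ M ∧ IsBlock M := by
  refine zorn_subset_nonempty {S : Set E | ∀ x ∈ S, ∀ y ∈ S, Compatible x y} ?_ A hA
  intro c hc hchain _
  refine ⟨⋃₀ c, ?_, fun s hs => Set.subset_sUnion_of_mem hs⟩
  rintro x ⟨s, hs, hx⟩ y ⟨t, ht, hy⟩
  rcases hchain.total hs ht with h | h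
  · exact hc ht x (h hx) y hy
  · exact hc hs x hx y (h hy)

theorem exists_isBlock_insert {E : Type*} [LatticeEffectAlgebra E] {A : Set E} {x : E}
    (hA : ∀ y ∈ A, ∀ z ∈ A, Compatible y z) (hx : ∀ y ∈ A, Compatible x y) :
    ∃ M, x ∈ M ∧ A ⊆ M ∧ IsBlock M := by
  obtain ⟨M, hM, hb⟩ := exists_isBlock_superset (A := insert x A) (by
    rintro y (rfl | hy) z (rfl | hz)
    · exact compatible_of_le le_rfl
    · exact hx z hz
    · exact (hx y hy).symm
    · exact hA y hy z hz)
  exact ⟨M, hM (Set.mem_insert _ _), (Set.subset_insert _ _).trans hM, hb⟩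

variable {E : Type*} [CompleteLatticeEffectAlgebra E] {M : Set E}

theorem IsBlock.compatible (hM : IsBlock M) {x y : E} (hx : x ∈ M) (hy : y ∈ M) :
    Compatible x y :=
  hM.prop x hx y hy

theorem IsBlock.mem_of_compatible (hM : IsBlock M) {x : E} (hx : ∀ y ∈ M, Compatible x y) :
    x ∈ M := by
  obtain ⟨N, hxN, hMN, hN⟩ := exists_isBlock_insert hM.prop hx
  exact hM.le_of_ge hN.prop hMN hxN

theorem IsBlock.sSup_mem (hM : IsBlock M) {S : Set E} (hS : S ⊆ M) : sSup S ∈ M :=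
  hM.mem_of_compatible fun _ hy => compatible_sSup fun _ hx => hM.compatible (hS hx) hy

theorem IsBlock.inf_mem (hM : IsBlock M) {x y : E} (hx : x ∈ M) (hy : y ∈ M) : x ⊓ y ∈ M :=
  hM.mem_of_compatible fun _ hz => compatible_inf (hM.compatible hx hz) (hM.compatible hy hz)

theorem IsBlock.orthosupplement_mem (hM : IsBlock M) {x : E} (hx : x ∈ M) :
    orthosupplement x ∈ M :=
  hM.mem_of_compatible fun _ hz => (hM.compatible hx hz).orthosupplement_left

theorem IsBlock.add_mem (hM : IsBlock M) {x y s : E} (h : (x : WithTop E) + y = s) (hx : x ∈ M)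
    (hy : y ∈ M) : s ∈ M :=
  hM.mem_of_compatible fun _ hz =>
    compatible_of_add_eq h (hM.compatible hx hz) (hM.compatible hy hz)

theorem IsBlock.right_mem_of_add (hM : IsBlock M) {x y s : E} (h : (x : WithTop E) + y = s)
    (hx : x ∈ M) (hs : s ∈ M) : y ∈ M :=
  hM.mem_of_compatible fun _ hz =>
    compatible_of_add_eq_left h (hM.compatible hs hz) (hM.compatible hx hz)

theorem IsBlock.zero_mem (hM : IsBlock M) : (0 : E) ∈ M := by
  rw [← bot_eq_zero, ← sSup_empty]
  exact hM.sSup_mem (Set.empty_subset _)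

/-- In a block-finite lattice effect algebra every block is cut out by finitely many of its
elements. -/
theorem IsBlock.exists_finite (hE : BlockFinite E) (hM : IsBlock M) :
    ∃ F : Set E, F.Finite ∧ F ⊆ M ∧ ∀ x, (∀ f ∈ F, Compatible x f) → x ∈ M := by
  -- One witness per block `N`: an element of `M` outside `N`, or the dummy 0 when `M` ⊆ `N`, where
  -- maximality forces equality.
  have hsep : ∀ N : Set E, ∃ f ∈ M, IsBlock N → f ∈ N → N = M := by
    intro N
    by_cases hN : M ⊆ N
    · exact ⟨0, hM.zero_mem, fun hb _ => (hM.eq_of_subset hb.prop hN).symm⟩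
    · obtain ⟨f, hf, hfN⟩ := Set.not_subset.1 hN
      exact ⟨f, hf, fun _ h => absurd h hfN⟩
  choose f hfM hf using hsep
  have hFM : f '' {N | IsBlock N} ⊆ M := by
    rintro _ ⟨N, -, rfl⟩
    exact hfM N
  refine ⟨f '' {N | IsBlock N}, hE.image f, hFM, fun x hx => ?_⟩
  obtain ⟨N, hxN, hFN, hN⟩ := exists_isBlock_insert
    (fun y hy z hz => hM.compatible (hFM hy) (hFM hz)) hx
  rwa [← hf N hN (hFN ⟨N, hN, rfl⟩)]

/-- Shrink `d` to a nonzero e all of whose lower bounds are compatible with the finite set cutting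
out `M`. Then any atom of `E` below e lies in `M`. -/
theorem IsBlock.exists_isAtom_le [IsAtomic E] (hE : BlockFinite E) (hM : IsBlock M) {d : E}
    (hd : d ∈ M) (hd0 : d ≠ 0) : ∃ p ∈ M, IsAtom p ∧ p ≤ d := by
  obtain ⟨F, hF, hFM, hcut⟩ := hM.exists_finite hE
  have key : ∃ e ∈ M, e ≠ 0 ∧ e ≤ d ∧ ∀ x ≤ e, ∀ f ∈ F, Compatible x f := by
    clear hcut
    induction F, hF using Set.Finite.induction_on with
    | empty => exact ⟨d, hd, hd0, le_rfl, by simp⟩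
    | @insert g F _ _ ih =>
      obtain ⟨e, heM, he0, hed, he⟩ := ih ((Set.subset_insert _ _).trans hFM)
      have hgM : g ∈ M := hFM (Set.mem_insert _ _)
      -- If the meet is 0, compatibility gives e ≤ g', so everything below `e` is orthogonal to `g`;
      -- otherwise pass to e ∧ g, below which everything is under `g`.
      by_cases h0 : e ⊓ g = 0
      · refine ⟨e, heM, he0, hed, ?_⟩
        rintro x hx f (rfl | hf)
        · obtain ⟨c, hc, hgc⟩ :=
            (compatible_iff_splits.1 (hM.compatible heM hgM)).exists_inf_add_sup
          rw [h0, withTop_zero, zero_add, WithTop.coe_inj] at hc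
          refine compatible_of_le_or_le_orthosupplement (.inr (hx.trans ?_))
          rw [← WithTop.coe_le_coe, ← add_ne_top_iff, ← hc, add_comm, hgc]
          exact WithTop.coe_ne_top
        · exact he x hx f hf
      · refine ⟨e ⊓ g, hM.inf_mem heM hgM, h0, inf_le_left.trans hed, ?_⟩
        rintro x hx f (rfl | hf)
        · exact compatible_of_le (hx.trans inf_le_right)
        · exact he x (hx.trans inf_le_left) f hf
  obtain ⟨e, -, he0, hed, he⟩ := key
  obtain ⟨p, hp, hpe⟩ := (IsAtomic.eq_bot_or_exists_atom_le e).resolve_left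
    (by rwa [bot_eq_zero])
  exact ⟨p, hcut p (he p hpe), hp, hpe.trans hed⟩

/-- Since p ∧ v = 0, compatibility gives v + p = p ∨ v ≤ v + u; cancel `v`. -/
theorem le_of_isAtom_of_le_add {p v : E} {u : WithTop E} (hp : IsAtom p) (hpv : Compatible p v)
    (hnot : ¬ p ≤ v) (hle : (p : WithTop E) ≤ v + u) (htop : v + u ≠ ⊤) : p ≤ u := by
  obtain ⟨c, hc, hvc⟩ := (compatible_iff_splits.1 hpv).exists_inf_add_sup
  have h0 : p ⊓ v = 0 := by
    rw [← bot_eq_zero]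
    exact (hp.le_iff.1 inf_le_left).resolve_right fun h => hnot (inf_eq_left.1 h)
  rw [h0, withTop_zero, zero_add, WithTop.coe_inj] at hc
  subst hc
  refine le_of_withTop_add_le_add_left ?_ htop
  rw [hvc, WithTop.coe_sup]
  exact sup_le hle le_self_add

end Blocks

/-! ### Limits along ultrafilters inside a block -/

section Limits

variable {E : Type*} [CompleteLatticeEffectAlgebra E] {M : Set E} {I : Type*}

/-- The lower limit of `f` along `G`, computed from elements of `M`. -/
def lowerLimit (M : Set E) (G : Filter I) (f : I → E) : E :=
  sSup {c | c ∈ M ∧ ∀ᶠ i in G, c ≤ f i}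

theorem le_lowerLimit {G : Filter I} {f : I → E} {c : E} (hc : c ∈ M)
    (h : ∀ᶠ i in G, c ≤ f i) : c ≤ lowerLimit M G f :=
  le_sSup ⟨hc, h⟩

theorem IsBlock.lowerLimit_mem (hM : IsBlock M) (G : Filter I) (f : I → E) :
    lowerLimit M G f ∈ M :=
  hM.sSup_mem fun _ h => h.1

theorem zero_le_elem (a : E) : 0 ≤ a := bot_eq_zero (E := E) ▸ bot_le

theorem lowerLimit_add_le (hM : IsBlock M) {G : Filter I} {f : I → E} {y : WithTop E} {t : E}
    (h : ∀ c ∈ M, (∀ᶠ i in G, c ≤ f i) → (c : WithTop E) + y ≤ t) :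
    ((lowerLimit M G f : E) : WithTop E) + y ≤ t := by
  have hy : y ≤ t := by
    simpa [withTop_zero] using h 0 hM.zero_mem (.of_forall fun _ => zero_le_elem _)
  lift y to E using ne_top_of_le_coe hy
  obtain ⟨r, hr⟩ := coe_le_iff_exists_add.1 (WithTop.coe_le_coe.1 hy)
  rw [add_comm, ← hr]
  gcongr
  refine WithTop.coe_le_coe.2 (sSup_le fun c hc => ?_)
  have := h c hc.1 hc.2
  rw [add_comm, ← hr] at this
  exact WithTop.coe_le_coe.1 (le_of_withTop_add_le_add_left this (hr ▸ WithTop.coe_ne_top))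

/-- Otherwise adding `p` preserves eventual lower bounds in `M`; taking suprema, L(f) + p ≤ L(f), so
p = 0. -/
theorem exists_eventually_le_not_add_le (hM : IsBlock M) (G : Ultrafilter I) (f : I → E) {p : E}
    (hp : p ∈ M) (hp0 : p ≠ 0) : ∃ w ∈ M, (∀ᶠ i in G, w ≤ f i) ∧
      ∀ᶠ i in G, ¬ (w : WithTop E) + p ≤ f i := by
  by_contra hcon
  have hstep : ∀ c ∈ M, (∀ᶠ i in G, c ≤ f i) →
      (c : WithTop E) + p ≤ (lowerLimit M (G : Filter I) f : E) := by
    intro c hc hcf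
    have h2 : ∀ᶠ i in G, (c : WithTop E) + p ≤ f i := by
      by_contra h2
      exact hcon ⟨c, hc, hcf, Ultrafilter.eventually_not.2 h2⟩
    obtain ⟨i, hi⟩ := h2.exists
    obtain ⟨w, hw, -⟩ := exists_coe_add_of_coe_le hi
    simp only [hw, WithTop.coe_le_coe] at h2 ⊢
    exact le_lowerLimit (hM.add_mem hw hc hp) h2
  have h3 := withTop_eq_zero_of_add_le (lowerLimit_add_le hM hstep) WithTop.coe_ne_top
  exact hp0 (WithTop.coe_inj.1 (h3.trans withTop_zero.symm))

theorem lowerLimit_add_add_eq_one [IsAtomic E] (hE : BlockFinite E) (hM : IsBlock M)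
    (G : Ultrafilter I) {f g h : I → E} (hf : ∀ᶠ i in G, f i ∈ M) (hg : ∀ᶠ i in G, g i ∈ M)
    (hh : ∀ᶠ i in G, h i ∈ M)
    (hsum : ∀ᶠ i in G, (f i : WithTop E) + g i + h i = (1 : E)) :
    ((lowerLimit M (G : Filter I) f : E) : WithTop E) + lowerLimit M (G : Filter I) g +
      lowerLimit M (G : Filter I) h = (1 : E) := by
  have hle : ((lowerLimit M (G : Filter I) f : E) : WithTop E) + lowerLimit M (G : Filter I) g +
      lowerLimit M (G : Filter I) h ≤ (1 : E) := by
    rw [add_assoc]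
    refine lowerLimit_add_le hM fun a _ ha => ?_
    rw [add_left_comm]
    refine lowerLimit_add_le hM fun b _ hb => ?_
    rw [← add_assoc, add_comm]
    refine lowerLimit_add_le hM fun c _ hc => ?_
    obtain ⟨i, hs, hai, hbi, hci⟩ := (hsum.and (ha.and (hb.and hc))).exists
    rw [← hs, add_comm (b : WithTop E), add_comm (c : WithTop E)]
    exact add_le_add (add_le_add (WithTop.coe_le_coe.2 hai) (WithTop.coe_le_coe.2 hbi))
      (WithTop.coe_le_coe.2 hci)
  obtain ⟨s, hs, -⟩ := exists_coe_add_of_coe_le hle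
  obtain ⟨t, ht, -⟩ := exists_coe_add_of_coe_le (le_self_add.trans hle)
  have hsM : s ∈ M := hM.add_mem (ht ▸ hs)
    (hM.add_mem ht (hM.lowerLimit_mem _ _) (hM.lowerLimit_mem _ _)) (hM.lowerLimit_mem _ _)
  have hs1 := coe_add_orthosupplement s
  by_cases hd : orthosupplement s = 0
  · rw [hs, ← hs1, hd, withTop_zero, add_zero]
  exfalso
  obtain ⟨p, hpM, hp, hpd⟩ := hM.exists_isAtom_le hE (hM.orthosupplement_mem hsM) hd
  have hp0 : p ≠ 0 := bot_eq_zero (E := E) ▸ hp.1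
  obtain ⟨a, haM, haf, hpa⟩ := exists_eventually_le_not_add_le hM G f hpM hp0
  obtain ⟨b, hbM, hbg, hpb⟩ := exists_eventually_le_not_add_le hM G g hpM hp0
  obtain ⟨c, hcM, hch, hpc⟩ := exists_eventually_le_not_add_le hM G h hpM hp0
  -- The atom fits above a + b + c because it fits into the gap s' left by the three limits.
  have htot : (a : WithTop E) + b + c + p ≤ (1 : E) := by
    rw [← hs1, ← hs]
    exact add_le_add (add_le_add (add_le_add (WithTop.coe_le_coe.2 (le_lowerLimit haM haf))
      (WithTop.coe_le_coe.2 (le_lowerLimit hbM hbg)))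
      (WithTop.coe_le_coe.2 (le_lowerLimit hcM hch))) (WithTop.coe_le_coe.2 hpd)
  obtain ⟨i, hi, hfi, hgi, hhi, hai, hbi, hci, hpai, hpbi, hpci⟩ :=
    (hsum.and (hf.and (hg.and (hh.and (haf.and (hbg.and (hch.and
      (hpa.and (hpb.and hpc))))))))).exists
  obtain ⟨u, hu⟩ := coe_le_iff_exists_add.1 hai
  obtain ⟨v, hv⟩ := coe_le_iff_exists_add.1 hbi
  obtain ⟨w, hw⟩ := coe_le_iff_exists_add.1 hci
  have hone : (a : WithTop E) + b + c + (u + (v + w)) = (1 : E) := by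
    rw [← hi, ← hu, ← hv, ← hw]; abel
  have hptop : (u : WithTop E) + (v + w) ≠ ⊤ := by
    refine ne_top_of_le_coe (a := 1) ?_
    rw [← hone]; exact le_add_self
  have hnle : ∀ {x y z : E}, (x : WithTop E) + y = z → ¬ (x : WithTop E) + p ≤ z → ¬ p ≤ y := by
    intro x y z hxy hn hpy
    refine hn (hxy ▸ ?_)
    gcongr
    exact WithTop.coe_le_coe.2 hpy
  have h1 : (p : WithTop E) ≤ u + (v + w) :=
    le_of_withTop_add_le_add_left (hone ▸ htot) (hone ▸ WithTop.coe_ne_top)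
  have h2 : (p : WithTop E) ≤ v + w :=
    le_of_isAtom_of_le_add hp (hM.compatible hpM (hM.right_mem_of_add hu haM hfi))
      (hnle hu hpai) h1 hptop
  have h3 : (p : WithTop E) ≤ w :=
    le_of_isAtom_of_le_add hp (hM.compatible hpM (hM.right_mem_of_add hv hbM hgi))
      (hnle hv hpbi) h2 (ne_top_of_le_ne_top hptop le_add_self)
  exact hnle hw hpci (WithTop.coe_le_coe.1 h3)

theorem lowerLimit_orthosupplement [IsAtomic E] (hE : BlockFinite E) (hM : IsBlock M)
    (G : Ultrafilter I) {f : I → E} (hf : ∀ᶠ i in G, f i ∈ M) :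
    lowerLimit M (G : Filter I) (fun i => orthosupplement (f i)) =
      orthosupplement (lowerLimit M (G : Filter I) f) := by
  have h0 : lowerLimit M (G : Filter I) (fun _ => (0 : E)) = 0 := by
    refine le_antisymm (sSup_le fun c hc => ?_) (zero_le_elem _)
    obtain ⟨i, hi⟩ := hc.2.exists
    exact hi
  have := lowerLimit_add_add_eq_one hE hM G (g := fun _ => 0)
    (h := fun i => orthosupplement (f i)) hf (.of_forall fun _ => hM.zero_mem)
    (hf.mono fun i hi => hM.orthosupplement_mem hi)
    (.of_forall fun i => by rw [withTop_zero, add_zero, coe_add_orthosupplement])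
  rw [h0, withTop_zero, add_zero] at this
  exact (orthosupplement_eq_of_add_eq_one this).symm

/-- The point is that `c` need not belong to `M`: by duality L(f) is also the infimum of the
eventual upper bounds in `M`, and `c` is below each of these. -/
theorem le_lowerLimit_of_eventually_le [IsAtomic E] (hE : BlockFinite E) (hM : IsBlock M)
    (G : Ultrafilter I) {f : I → E} (hf : ∀ᶠ i in G, f i ∈ M) {c : E}
    (hc : ∀ᶠ i in G, c ≤ f i) : c ≤ lowerLimit M (G : Filter I) f := by
  rw [← orthosupplement_orthosupplement (lowerLimit M (G : Filter I) f), le_orthosupplement_comm,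
    ← lowerLimit_orthosupplement hE hM G hf]
  refine sSup_le fun d hd => ?_
  obtain ⟨i, hi, hi'⟩ := (hc.and hd.2).exists
  exact le_orthosupplement_comm.1 (hi.trans (le_orthosupplement_comm.1 hi'))

theorem lowerLimit_le_of_eventually_le {G : Filter I} [G.NeBot] {f : I → E} {c : E}
    (hc : ∀ᶠ i in G, f i ≤ c) : lowerLimit M G f ≤ c := by
  refine sSup_le fun d hd => ?_
  obtain ⟨i, hi, hi'⟩ := (hc.and hd.2).exists
  exact hi'.trans hi

end Limits

/-! ### Interval and order topologies -/

section Topology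

open Filter

theorem tendsto_intervalTopology_iff {L I : Type*} [Preorder L] {G : Filter I} {f : I → L}
    {a : L} : Tendsto f G (@nhds L (intervalTopology L) a) ↔
      ∀ c d, c ≤ d → a ∉ Set.Icc c d → ∀ᶠ i in G, f i ∉ Set.Icc c d := by
  rw [TopologicalSpace.tendsto_nhds_generateFrom_iff]
  constructor
  · exact fun h c d hcd ha => h _ ⟨c, d, hcd, rfl⟩ ha
  · rintro h _ ⟨c, d, hcd, rfl⟩ ha
    exact h c d hcd ha

theorem mem_Icc_of_tendsto_intervalTopology {L I : Type*} [Preorder L] {G : Filter I} [G.NeBot]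
    {f : I → L} {a c d : L} (hf : Tendsto f G (@nhds L (intervalTopology L) a))
    (h : ∀ᶠ i in G, f i ∈ Set.Icc c d) : a ∈ Set.Icc c d := by
  by_contra ha
  obtain ⟨i, hi⟩ := h.exists
  obtain ⟨j, hj, hj'⟩ :=
    (h.and (tendsto_intervalTopology_iff.1 hf c d (hi.1.trans hi.2) ha)).exists
  exact hj' hj

/-- If the net is cofinally in [c, d], monotonicity puts every upper envelope value above c and
every lower one below d, so the limit is in [c, d]. -/
theorem respectsOrderConvergence_intervalTopology (L : Type u) [Preorder L] :
    RespectsOrderConvergence (intervalTopology L) := by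
  rintro I _ _ _ x a ⟨l, r, hx, hl, hla, hr, hra⟩
  refine tendsto_intervalTopology_iff.2 fun c d _ ha => ?_
  by_contra hcon
  rw [← Filter.Frequently, Filter.frequently_atTop] at hcon
  refine ha ⟨hra.2 ?_, hla.2 ?_⟩
  · rintro _ ⟨i, rfl⟩
    obtain ⟨j, hij, hj⟩ := hcon i
    exact hj.1.trans ((hx j).2.trans (hr hij))
  · rintro _ ⟨i, rfl⟩
    obtain ⟨j, hij, hj⟩ := hcon i
    exact (hl hij).trans ((hx j).1.trans hj.2)

/-- An ultrafilter whose lower and upper limit coincide converges in the order topology. -/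
theorem ultrafilter_le_nhds_orderTopology {L : Type u} [CompleteLattice L] {G : Ultrafilter L}
    {a : L} (hl : IsLUB {c | ∀ᶠ x in (G : Filter L), c ≤ x} a)
    (hr : IsGLB {c | ∀ᶠ x in (G : Filter L), x ≤ c} a) :
    (G : Filter L) ≤ @nhds L (orderTopology L) a := by
  obtain ⟨J, S, e, hS, he, hJ⟩ : ∃ (J : Type u) (S : J → Set L) (e : J → L), (∀ j, S j ∈ G) ∧
      (∀ j, e j ∈ S j) ∧ ∀ s ∈ G, ∀ x ∈ s, ∃ j, S j = s ∧ e j = x :=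
    ⟨{t : Set L × L // t.1 ∈ G ∧ t.2 ∈ t.1}, fun t => t.1.1, fun t => t.1.2, fun t => t.2.1,
      fun t => t.2.2, fun s hs x hx => ⟨⟨(s, x), hs, hx⟩, rfl, rfl⟩⟩
  -- The net of pairs (s, x) with x ∈ s ∈ `G`, ordered by reverse inclusion of s; its envelopes are
  -- inf s and sup s.
  let _ : Preorder J := Preorder.lift fun j => OrderDual.toDual (S j)
  have hmem : ∀ s ∈ G, ∃ j, S j = s := fun s hs => by
    obtain ⟨x, hx⟩ := G.nonempty_of_mem hs
    obtain ⟨j, hj, -⟩ := hJ s hs x hx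
    exact ⟨j, hj⟩
  have : Nonempty J := (hmem _ univ_mem).nonempty
  have : IsDirectedOrder J := ⟨fun s t => by
    obtain ⟨r, hr⟩ := hmem _ (inter_mem (hS s) (hS t))
    exact ⟨r, hr.trans_subset Set.inter_subset_left, hr.trans_subset Set.inter_subset_right⟩⟩
  have hconv : OrderConverges e a := by
    refine ⟨fun j => sInf (S j), fun j => sSup (S j),
      fun j => ⟨sInf_le (he j), le_sSup (he j)⟩, fun s t h => sInf_le_sInf h, ⟨?_, ?_⟩,
      fun s t h => sSup_le_sSup h, ⟨?_, ?_⟩⟩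
    · rintro _ ⟨j, rfl⟩
      exact hl.1 (mem_of_superset (hS j) fun x hx => sInf_le hx)
    · refine fun b hb => hl.2 fun c hc => ?_
      obtain ⟨j, hj⟩ := hmem _ hc
      refine le_trans ?_ (hb ⟨j, rfl⟩)
      simp only [hj]
      exact le_sInf fun x hx => hx
    · rintro _ ⟨j, rfl⟩
      exact hr.1 (mem_of_superset (hS j) fun x hx => le_sSup hx)
    · refine fun b hb => hr.2 fun c hc => ?_
      obtain ⟨j, hj⟩ := hmem _ hc
      refine (hb ⟨j, rfl⟩).trans ?_
      simp only [hj]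
      exact sSup_le fun x hx => hx
  intro V hV
  obtain ⟨j, hj⟩ := eventually_atTop.1 (hconv.tendsto_orderTopology.eventually hV)
  refine mem_of_superset (hS j) fun x hx => ?_
  obtain ⟨k, hk, rfl⟩ := hJ (S j) (hS j) x hx
  exact hj k hk.le

variable {E : Type*} [CompleteLatticeEffectAlgebra E] {M : Set E} {I : Type*}

theorem exists_isBlock_eventually (hE : BlockFinite E) (G : Ultrafilter I) (A : I → Set E)
    (hA : ∀ i, ∀ x ∈ A i, ∀ y ∈ A i, Compatible x y) :
    ∃ M, IsBlock M ∧ ∀ᶠ i in G, A i ⊆ M := by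
  have h : (⋃ M ∈ {M : Set E | IsBlock M}, {i | A i ⊆ M}) ∈ G := by
    refine univ_mem' fun i => ?_
    obtain ⟨M, hAM, hM⟩ := exists_isBlock_superset (hA i)
    simp only [Set.mem_iUnion]
    exact ⟨M, hM, hAM⟩
  exact (Ultrafilter.finite_biUnion_mem_iff hE).1 h

variable [IsAtomic E]

theorem le_lowerLimit_of_forall_le (hE : BlockFinite E) (hM : IsBlock M) (G : Ultrafilter I)
    {f : I → E} (hf : ∀ᶠ i in G, f i ∈ M) {c : E}
    (h : ∀ d ∈ M, (∀ᶠ i in G, f i ≤ d) → c ≤ d) : c ≤ lowerLimit M (G : Filter I) f := by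
  rw [← orthosupplement_orthosupplement (lowerLimit M (G : Filter I) f), le_orthosupplement_comm,
    ← lowerLimit_orthosupplement hE hM G hf]
  refine sSup_le fun d hd => le_orthosupplement_comm.1 (h _ (hM.orthosupplement_mem hd.1) ?_)
  exact hd.2.mono fun i hi => le_orthosupplement_comm.1 hi

theorem tendsto_lowerLimit (hE : BlockFinite E) (hM : IsBlock M) (G : Ultrafilter I)
    {f : I → E} (hf : ∀ᶠ i in G, f i ∈ M) :
    Tendsto f G (@nhds E (intervalTopology E) (lowerLimit M (G : Filter I) f)) := by
  refine tendsto_intervalTopology_iff.2 fun c d _ ha => Ultrafilter.eventually_not.2 fun h => ha ?_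
  exact ⟨le_lowerLimit_of_eventually_le hE hM G hf (h.mono fun i hi => hi.1),
    lowerLimit_le_of_eventually_le (h.mono fun i hi => hi.2)⟩

theorem eq_lowerLimit_of_tendsto (hE : BlockFinite E) (hM : IsBlock M) (G : Ultrafilter I)
    {f : I → E} (hf : ∀ᶠ i in G, f i ∈ M) {a : E}
    (ha : Tendsto f G (@nhds E (intervalTopology E) a)) :
    a = lowerLimit M (G : Filter I) f := by
  refine le_antisymm (le_lowerLimit_of_forall_le hE hM G hf fun d _ hd => ?_) (sSup_le fun c hc => ?_)
  · exact (mem_Icc_of_tendsto_intervalTopology ha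
      (hd.mono fun i hi => ⟨zero_le_elem _, hi⟩)).2
  · exact (mem_Icc_of_tendsto_intervalTopology ha (hc.2.mono fun i hi => ⟨hi, le_one _⟩)).1

theorem intervalTopology_eq_orderTopology {E : Type u} [CompleteLatticeEffectAlgebra E]
    [IsAtomic E] (hE : BlockFinite E) : intervalTopology E = orderTopology E := by
  refine le_antisymm (le_of_nhds_le_nhds fun a => ?_)
    ((isLeast_orderTopology E).2 (respectsOrderConvergence_intervalTopology E))
  refine Filter.le_iff_ultrafilter.2 fun G hG => ?_
  obtain ⟨M, hM, hGM⟩ := exists_isBlock_eventually hE G (fun x => {x}) (by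
    rintro i x rfl y rfl
    exact compatible_of_le le_rfl)
  have hf : ∀ᶠ x in (G : Filter E), id x ∈ M := hGM.mono fun x hx => hx rfl
  rw [eq_lowerLimit_of_tendsto hE hM G hf (tendsto_id'.2 hG)]
  refine ultrafilter_le_nhds_orderTopology ⟨?_, fun b hb => ?_⟩ ⟨?_, fun b hb => ?_⟩
  · exact fun c hc => le_lowerLimit_of_eventually_le hE hM G hf hc
  · exact sSup_le fun c hc => hb hc.2
  · exact fun c hc => lowerLimit_le_of_eventually_le hc
  · exact le_lowerLimit_of_forall_le hE hM G hf fun d _ hd => hb hd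

theorem tendsto_osum (hE : BlockFinite E) {l : Filter I} [l.NeBot] {x y : I → E} {a b : E}
    (hxy : ∀ i, x i ≤ orthosupplement (y i))
    (hx : Tendsto x l (@nhds E (intervalTopology E) a))
    (hy : Tendsto y l (@nhds E (intervalTopology E) b)) :
    ∃ hab : a ≤ orthosupplement b, Tendsto (fun i => osum (x i) (y i) (hxy i)) l
      (@nhds E (intervalTopology E) (osum a b hab)) := by
  have key : ∀ G : Ultrafilter I, (G : Filter I) ≤ l → ∃ hab : a ≤ orthosupplement b,
      Tendsto (fun i => osum (x i) (y i) (hxy i)) G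
        (@nhds E (intervalTopology E) (osum a b hab)) := by
    intro G hG
    obtain ⟨M, hM, hGM⟩ := exists_isBlock_eventually hE G (fun i => {x i, y i}) (by
      intro i
      have h : Compatible (x i) (y i) :=
        compatible_of_le_or_le_orthosupplement (.inr (hxy i))
      rintro z (rfl | rfl) w (rfl | rfl)
      · exact compatible_of_le le_rfl
      · exact h
      · exact h.symm
      · exact compatible_of_le le_rfl)
    have hxM : ∀ᶠ i in G, x i ∈ M := hGM.mono fun i h => h (by simp)
    have hyM : ∀ᶠ i in G, y i ∈ M := hGM.mono fun i h => h (by simp)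
    have hzM : ∀ᶠ i in G, osum (x i) (y i) (hxy i) ∈ M :=
      (hxM.and hyM).mono fun i h => hM.add_mem (coe_osum (hxy i)).symm h.1 h.2
    -- The third summand is (x ⊕ y)', so the sum is 1 at every index.
    have hsum := lowerLimit_add_add_eq_one hE hM G hxM hyM
      (hzM.mono fun i => hM.orthosupplement_mem)
      (.of_forall fun i => by rw [← coe_osum (hxy i), coe_add_orthosupplement])
    rw [← eq_lowerLimit_of_tendsto hE hM G hxM (hx.mono_left hG),
      ← eq_lowerLimit_of_tendsto hE hM G hyM (hy.mono_left hG),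
      lowerLimit_orthosupplement hE hM G hzM] at hsum
    have hab : a ≤ orthosupplement b := by
      rw [← WithTop.coe_le_coe, ← add_ne_top_iff]
      refine ne_top_of_le_coe (a := 1) ?_
      rw [← hsum]
      exact le_self_add
    refine ⟨hab, ?_⟩
    rw [← coe_osum hab] at hsum
    have h := congrArg orthosupplement (orthosupplement_eq_of_add_eq_one hsum)
    rw [orthosupplement_orthosupplement, orthosupplement_orthosupplement] at h
    rw [h]
    exact tendsto_lowerLimit hE hM G hzM
  -- One ultrafilter suffices for a ≤ b'; convergence needs all of them.
  obtain ⟨hab, -⟩ := key (Ultrafilter.of l) (Ultrafilter.of_le l)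
  exact ⟨hab, (tendsto_iff_ultrafilter _ _ _).2 fun G hG => (key G hG).2⟩

end Topology
end EffectAlgebra

theorem mainTheorem8 {E : Type u} [CompleteLatticeEffectAlgebra E] [IsAtomic E]
    (hE : EffectAlgebra.BlockFinite E) :
    (∀ (I : Type v) [Preorder I] [IsDirectedOrder I] [Nonempty I] (x y : I → E) (a b : E)
        (hxy : ∀ i, x i ≤ EffectAlgebra.orthosupplement (y i)),
        Filter.Tendsto x Filter.atTop (@nhds E (intervalTopology E) a) →
        Filter.Tendsto y Filter.atTop (@nhds E (intervalTopology E) b) →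
        ∃ hab : a ≤ EffectAlgebra.orthosupplement b,
          Filter.Tendsto (fun i => EffectAlgebra.osum (x i) (y i) (hxy i)) Filter.atTop
            (@nhds E (intervalTopology E) (EffectAlgebra.osum a b hab))) ∧
      intervalTopology E = orderTopology E :=
  ⟨fun _ _ _ _ _ _ _ _ hxy hx hy => EffectAlgebra.tendsto_osum hE hxy hx hy,
    EffectAlgebra.intervalTopology_eq_orderTopology hE⟩
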